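/- A loop $Q=(Q,\cdot,\backslash,/,1)$ is an algebra satisfying $x\backslash(x\cdot y)=x\cdot(x\backslash y)=y=(y\cdot x)/x=(y/x)\cdot x$ and $x\cdot 1=x=1\cdot x$; it is a Moufang loop if $x(y\cdot xz)=(xy\cdot x)z$ for all $x,y,z$. For $u\in Q$ let $L_u(v)=uv$ and $R_u(v)=vu$, let $\operatorname{Mlt}(Q)=\langle L_u,R_u:u\in Q\rangle$ be the multiplication group of $Q$, acting on $Q$ from the left, and let $\operatorname{Inn}(Q)$ be the stabilizer of $1$ in $\operatorname{Mlt}(Q)$. A subloop $X$ of $Q$ is normal if $\varphi(X)=X$ for all $\varphi\in\operatorname{Inn}(Q)$. A congruence of $Q$ is an equivalence relation compatible with all operations of $Q$. A congruence $\alpha$ of $Q$ is abelian if for all $n\ge 0$, every $(n+1)$-ary loop term $t$ and all $a\mathrel{\alpha}b$ and $u_i\mathrel{\alpha}v_i$ ($1\le i\le n$), the equality $t(a,u_1,\dots,u_n)=t(a,v_1,\dots,v_n)$ implies $t(b,u_1,\dots,u_n)=t(b,v_1,\dots,v_n)$. A normal subloop $X$ induces an abelian congruence of $Q$ if the relation $\{(u,v):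 uX=vX\}$ is an abelian congruence of $Q$. A Moufang loop $Q$ admits triality automorphisms if there are automorphisms $\sigma,\rho$ of the group $\operatorname{Mlt}(Q)$ such that, for all $x\in Q$, $\sigma(L_x)=R_x^{-1}$, $\sigma(R_x)=L_x^{-1}$, $\rho(L_x)=R_x$ and $\rho(R_x)=L_x^{-1}R_x^{-1}$. In that case $\sigma$ and $\rho$ are unique, and a subgroup $U\le\operatorname{Mlt}(Q)$ is a triality subgroup if it is invariant under $\sigma$ and $\rho$. **Proposition.** Let $Q$ be a Moufang loop, possibly infinite, that is $3$-divisible (the map $x\mapsto x^3$ is onto $Q$) and admits triality automorphisms. Let $U\unlhd\operatorname{Mlt}(Q)$ be a nontrivial commutative triality subgroup. Then the orbit $X=U(1)=\{\varphi(1):\varphi\in U\}$ is a nontrivial normal subloop of $Q$ that induces an abelian congruence of $Q$. -/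

import Mathlib

namespace MoufangTriality

/-- A loop, as a universal algebra `(Q, ·, \, /, 1)`: `ldiv x y` is `x \ y` and `rdiv x y` is
`x / y`. -/
class Loop (Q : Type*) extends Mul Q, One Q where
  ldiv : Q → Q → Q
  rdiv : Q → Q → Q
  ldiv_mul : ∀ x y : Q, ldiv x (x * y) = y
  mul_ldiv : ∀ x y : Q, x * ldiv x y = y
  mul_rdiv : ∀ x y : Q, rdiv (y * x) x = y
  rdiv_mul : ∀ x y : Q, rdiv y x * x = y
  mul_one' : ∀ x : Q, x * 1 = x
  one_mul' : ∀ x : Q, 1 * x = x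

/-- A Moufang loop is a loop satisfying `x (y · xz) = (xy · x) z`. -/
def IsMoufang (Q : Type*) [Loop Q] : Prop :=
  ∀ x y z : Q, x * (y * (x * z)) = ((x * y) * x) * z

/-- Powers `x ^ n` (bracketed to the left; the bracketing is irrelevant in a Moufang loop). -/
def power {Q : Type*} [Loop Q] (x : Q) : ℕ → Q
  | 0 => 1
  | n + 1 => power x n * x

/-- `Q` is `d`-divisible if `x ↦ x ^ d` is onto. -/
def IsDivisibleBy (Q : Type*) [Loop Q] (d : ℕ) : Prop :=
  Function.Surjective (fun x : Q => power x d)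

/-- The left translation `L_u : v ↦ u v`. -/
def leftTr {Q : Type*} [Loop Q] (u : Q) : Equiv.Perm Q where
  toFun v := u * v
  invFun v := Loop.ldiv u v
  left_inv v := Loop.ldiv_mul u v
  right_inv v := Loop.mul_ldiv u v

/-- The right translation `R_u : v ↦ v u`. -/
def rightTr {Q : Type*} [Loop Q] (u : Q) : Equiv.Perm Q where
  toFun v := v * u
  invFun v := Loop.rdiv v u
  left_inv v := Loop.mul_rdiv u v
  right_inv v := Loop.rdiv_mul u v

/-- The multiplication group of `Q`, generated by all left and right translations. -/
def Mlt (Q : Type*) [Loop Q] : Subgroup (Equiv.Perm Q) :=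
  Subgroup.closure (Set.range leftTr ∪ Set.range rightTr)

/-- The inner mapping group: the elements of `Mlt Q` that fix `1`. -/
def Inn (Q : Type*) [Loop Q] : Subgroup (Equiv.Perm Q) :=
  Mlt Q ⊓ MulAction.stabilizer (Equiv.Perm Q) (1 : Q)

/-- `L_u` as an element of `Mlt Q`. -/
def mltL {Q : Type*} [Loop Q] (u : Q) : Mlt Q :=
  ⟨leftTr u, Subgroup.subset_closure (Or.inl ⟨u, rfl⟩)⟩

/-- `R_u` as an element of `Mlt Q`. -/
def mltR {Q : Type*} [Loop Q] (u : Q) : Mlt Q :=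
  ⟨rightTr u, Subgroup.subset_closure (Or.inr ⟨u, rfl⟩)⟩

/-- The automorphism `σ` of `Mlt Q` extends `L_x ↦ R_x⁻¹`, `R_x ↦ L_x⁻¹`. -/
def IsTrialitySigma {Q : Type*} [Loop Q] (σ : MulAut (Mlt Q)) : Prop :=
  ∀ x : Q, σ (mltL x) = (mltR x)⁻¹ ∧ σ (mltR x) = (mltL x)⁻¹

/-- The automorphism `ρ` of `Mlt Q` extends `L_x ↦ R_x`, `R_x ↦ L_x⁻¹ R_x⁻¹`. -/
def IsTrialityRho {Q : Type*} [Loop Q] (ρ : MulAut (Mlt Q)) : Prop :=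
  ∀ x : Q, ρ (mltL x) = mltR x ∧ ρ (mltR x) = (mltL x)⁻¹ * (mltR x)⁻¹

/-- `Q` admits triality automorphisms. -/
def AdmitsTriality (Q : Type*) [Loop Q] : Prop :=
  (∃ σ : MulAut (Mlt Q), IsTrialitySigma σ) ∧ ∃ ρ : MulAut (Mlt Q), IsTrialityRho ρ

/-- `U ≤ Mlt Q` is a triality subgroup: it is invariant under the triality automorphisms `σ` and
`ρ` (which are unique, since they are prescribed on generators, and exist when
`AdmitsTriality Q` holds). -/
def IsTrialitySubgroup {Q : Type*} [Loop Q] (U : Subgroup (Mlt Q)) : Prop :=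
  (∀ σ : MulAut (Mlt Q), IsTrialitySigma σ → ∀ u ∈ U, σ u ∈ U) ∧
    (∀ ρ : MulAut (Mlt Q), IsTrialityRho ρ → ∀ u ∈ U, ρ u ∈ U)

/-- The orbit `U(1)` of the element `1` under a subgroup `U` of `Mlt Q`. -/
def orbitOne {Q : Type*} [Loop Q] (U : Subgroup (Mlt Q)) : Set Q :=
  {x | ∃ φ ∈ U, (φ : Equiv.Perm Q) 1 = x}

/-- A subloop of `Q`. -/
structure Subloop (Q : Type*) [Loop Q] where
  carrier : Set Q
  one_mem : (1 : Q) ∈ carrier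
  mul_mem : ∀ {x y : Q}, x ∈ carrier → y ∈ carrier → x * y ∈ carrier
  ldiv_mem : ∀ {x y : Q}, x ∈ carrier → y ∈ carrier → Loop.ldiv x y ∈ carrier
  rdiv_mem : ∀ {x y : Q}, x ∈ carrier → y ∈ carrier → Loop.rdiv x y ∈ carrier

/-- A subloop is normal if it is mapped onto itself by all inner mappings. -/
def Subloop.IsNormal {Q : Type*} [Loop Q] (X : Subloop Q) : Prop :=
  ∀ φ ∈ Inn Q, φ '' X.carrier = X.carrier

/-- A congruence of the loop `Q`: an equivalence relation compatible with all operations. -/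
structure IsCongruence {Q : Type*} [Loop Q] (r : Q → Q → Prop) : Prop where
  equiv : Equivalence r
  mul : ∀ {a b c d : Q}, r a b → r c d → r (a * c) (b * d)
  ldiv : ∀ {a b c d : Q}, r a b → r c d → r (Loop.ldiv a c) (Loop.ldiv b d)
  rdiv : ∀ {a b c d : Q}, r a b → r c d → r (Loop.rdiv a c) (Loop.rdiv b d)

/-- Terms in the signature `(·, \, /, 1)` of loops, with variables in `ι`. -/
inductive LoopTerm (ι : Type) : Type
  | var : ι → LoopTerm ι
  | one : LoopTerm ι
  | mul : LoopTerm ι → LoopTerm ι → LoopTerm ι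
  | ldiv : LoopTerm ι → LoopTerm ι → LoopTerm ι
  | rdiv : LoopTerm ι → LoopTerm ι → LoopTerm ι

/-- The term operation of `Q` defined by a term. -/
def LoopTerm.eval {Q : Type*} [Loop Q] {ι : Type} (e : ι → Q) : LoopTerm ι → Q
  | .var i => e i
  | .one => 1
  | .mul s t => s.eval e * t.eval e
  | .ldiv s t => Loop.ldiv (s.eval e) (t.eval e)
  | .rdiv s t => Loop.rdiv (s.eval e) (t.eval e)

/-- `α` centralizes `β` over `δ` (the term condition): if `a α b` and `uᵢ β vᵢ` for all `i`, then
`t(a, u) δ t(a, v)` implies `t(b, u) δ t(b, v)`, for every `(n+1)`-ary term operation `t`. -/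
def Centralizes {Q : Type*} [Loop Q] (α β δ : Q → Q → Prop) : Prop :=
  ∀ (n : ℕ) (t : LoopTerm (Fin (n + 1))) (a b : Q) (u v : Fin n → Q),
    α a b → (∀ i, β (u i) (v i)) →
    δ (t.eval (Fin.cons a u : Fin (n + 1) → Q)) (t.eval (Fin.cons a v : Fin (n + 1) → Q)) →
    δ (t.eval (Fin.cons b u : Fin (n + 1) → Q)) (t.eval (Fin.cons b v : Fin (n + 1) → Q))

/-- `r` is an abelian congruence of `Q`: a congruence that centralizes itself over equality. -/
def IsAbelianCongruence {Q : Type*} [Loop Q] (r : Q → Q → Prop) : Prop :=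
  IsCongruence r ∧ Centralizes r r (fun a b => a = b)

/-- The relation `u X = v X` on `Q` given by a subloop `X`. -/
def Subloop.cosetRel {Q : Type*} [Loop Q] (X : Subloop Q) (u v : Q) : Prop :=
  leftTr u '' X.carrier = leftTr v '' X.carrier

/-- `X` induces an abelian congruence of `Q`. -/
def Subloop.InducesAbelianCongruence {Q : Type*} [Loop Q] (X : Subloop Q) : Prop :=
  IsAbelianCongruence X.cosetRel

end MoufangTriality

open MoufangTriality

/-! Triality makes every `g` in `Mlt Q` the product component of an autotopism: `σρ²(g) a * σρ(g) b
= g (a * b)` (`triality_autotopism`). On the invariant subgroup `U`, `A = σρ²` and `B = σρ` are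
involutive endomorphisms, so elements of `U` acting on either factor can be moved out of a product;
normality carries them past translations by conjugation. Hence the orbits of `U` form a congruence,
and, `U` being commutative, each loop term is affine along orbits: `t(u c) = τ(u) t(c)` with `τ` a
homomorphism (`exists_hom_eval_smul`). The term condition follows, and the orbits are the cosets of
`U(1)`. -/

namespace MoufangTriality

/-! ### Inverse properties and the right Moufang identity -/

section LoopBasics

variable {Q : Type*} [Loop Q]

theorem loop_mul_left_cancel {x y z : Q} (h : x * y = x * z) : y = z := by
  rw [← Loop.ldiv_mul x y, h, Loop.ldiv_mul]

theorem ldiv_eq_of_mul_eq {x y z : Q} (h : x * z = y) : Loop.ldiv x y = z := by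
  rw [← h, Loop.ldiv_mul]

theorem rdiv_eq_of_mul_eq {x y z : Q} (h : z * x = y) : Loop.rdiv y x = z := by
  rw [← h, Loop.mul_rdiv]

/-- The right inverse of an element of a loop. -/
def rinv (x : Q) : Q := Loop.ldiv x 1

theorem mul_rinv (x : Q) : x * rinv x = 1 := Loop.mul_ldiv x 1

namespace IsMoufang

theorem flexible (hM : IsMoufang Q) (x y : Q) : x * (y * x) = x * y * x := by
  simpa [Loop.mul_one'] using hM x y 1

theorem rinv_mul_cancel_left (hM : IsMoufang Q) (x z : Q) : rinv x * (x * z) = z := by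
  apply loop_mul_left_cancel (x := x)
  rw [hM, mul_rinv, Loop.one_mul']

theorem rinv_mul (hM : IsMoufang Q) (x : Q) : rinv x * x = 1 := by
  simpa [Loop.mul_one'] using hM.rinv_mul_cancel_left x 1

theorem rinv_rinv (hM : IsMoufang Q) (x : Q) : rinv (rinv x) = x :=
  ldiv_eq_of_mul_eq (hM.rinv_mul x)

theorem mul_rinv_cancel_left (hM : IsMoufang Q) (x z : Q) : x * (rinv x * z) = z := by
  simpa [hM.rinv_rinv] using hM.rinv_mul_cancel_left (rinv x) z

/-- The Moufang identity reads `L_{xyx} = L_x L_y L_x`; this is its inverse, evaluated at `x * b`.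
-/
theorem rinv_sandwich_mul (hM : IsMoufang Q) (x y b : Q) :
    rinv (x * y * x) * (x * b) = rinv x * (rinv y * b) := by
  have h := hM x y (rinv x * (rinv y * b))
  rw [hM.mul_rinv_cancel_left, hM.mul_rinv_cancel_left] at h
  rw [h, hM.rinv_mul_cancel_left]

theorem mul_rinv_mul_cancel (hM : IsMoufang Q) (w x : Q) : w * rinv x * x = w := by
  -- Put `y = (xw)⁻¹` and `s = (xyx)⁻¹`. Taking `b = 1` gives `s x = w`, and `b = x⁻¹` gives `s = w
  -- x⁻¹`.
  have h1 := hM.rinv_sandwich_mul x (rinv (x * w)) 1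
  have h2 := hM.rinv_sandwich_mul x (rinv (x * w)) (rinv x)
  rw [hM.rinv_rinv] at h1 h2
  rw [Loop.mul_one', Loop.mul_one', hM.rinv_mul_cancel_left] at h1
  rw [mul_rinv, Loop.mul_one', hM.flexible, hM.rinv_mul_cancel_left] at h2
  rwa [h2] at h1

theorem mul_mul_rinv_cancel (hM : IsMoufang Q) (w x : Q) : w * x * rinv x = w := by
  simpa [hM.rinv_rinv] using hM.mul_rinv_mul_cancel w (rinv x)

theorem rinv_mul_rev (hM : IsMoufang Q) (x y : Q) : rinv (x * y) = rinv y * rinv x := by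
  have h := hM.rinv_mul_cancel_left (x * y) (rinv y)
  rw [hM.mul_mul_rinv_cancel] at h
  rw [← h, hM.mul_mul_rinv_cancel]

/-- Inversion is an anti-automorphism, so it mirrors the defining identity. -/
theorem right_moufang (hM : IsMoufang Q) (x y z : Q) :
    z * x * y * x = z * (x * (y * x)) := by
  have h := congrArg rinv (hM (rinv x) (rinv y) (rinv z))
  simpa only [hM.rinv_mul_rev, hM.rinv_rinv] using h

end IsMoufang

end LoopBasics

/-! ### Triality automorphisms and autotopisms -/

section Triality

variable {Q : Type*} [Loop Q]

@[simp]
theorem mltL_smul (x y : Q) : mltL x • y = x * y := rfl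

@[simp]
theorem mltR_smul (x y : Q) : mltR x • y = y * x := rfl

@[simp]
theorem mltL_inv_smul (x y : Q) : (mltL x)⁻¹ • y = Loop.ldiv x y := rfl

@[simp]
theorem mltR_inv_smul (x y : Q) : (mltR x)⁻¹ • y = Loop.rdiv y x := rfl

theorem mlt_ext {g h : Mlt Q} (H : ∀ y : Q, g • y = h • y) : g = h :=
  Subtype.ext (Equiv.ext H)

theorem mlt_closure_eq_top :
    Subgroup.closure (Set.range (mltL (Q := Q)) ∪ Set.range mltR) = ⊤ := by
  have h : Set.range (mltL (Q := Q)) ∪ Set.range mltR =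
      ((↑) : Mlt Q → Equiv.Perm Q) ⁻¹' (Set.range leftTr ∪ Set.range rightTr) := by
    ext g
    simp only [Set.mem_union, Set.mem_range, Set.mem_preimage]
    simp only [Subtype.ext_iff]
    rfl
  rw [h]
  exact Subgroup.closure_closure_coe_preimage

theorem mlt_induction {p : Mlt Q → Prop} (hL : ∀ x, p (mltL x)) (hR : ∀ x, p (mltR x))
    (one : p 1) (mul : ∀ g h, p g → p h → p (g * h)) (inv : ∀ g, p g → p g⁻¹) (g : Mlt Q) :
    p g := by
  have hg : g ∈ Subgroup.closure (Set.range (mltL (Q := Q)) ∪ Set.range mltR) := by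
    rw [mlt_closure_eq_top]; trivial
  induction hg using Subgroup.closure_induction with
  | mem g hg =>
    rcases hg with ⟨x, rfl⟩ | ⟨x, rfl⟩
    exacts [hL x, hR x]
  | one => exact one
  | mul g h _ _ ihg ihh => exact mul g h ihg ihh
  | inv g _ ih => exact inv g ih

theorem IsMoufang.mltL_comm_mltR (hM : IsMoufang Q) (x : Q) :
    mltL x * mltR x = mltR x * mltL x :=
  mlt_ext fun y => by simp only [mul_smul, mltL_smul, mltR_smul, hM.flexible]

variable {σ ρ : MulAut (Mlt Q)}

theorem sigma_rho_rho_mltL (hM : IsMoufang Q) (hσ : IsTrialitySigma σ) (hρ : IsTrialityRho ρ)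
    (x : Q) : σ (ρ (ρ (mltL x))) = mltL x * mltR x := by
  simp [hσ x, hρ x, hM.mltL_comm_mltR]

theorem sigma_rho_rho_mltR (hσ : IsTrialitySigma σ) (hρ : IsTrialityRho ρ)
    (x : Q) : σ (ρ (ρ (mltR x))) = (mltR x)⁻¹ := by
  simp [hσ x, hρ x]

theorem sigma_rho_mltL (hσ : IsTrialitySigma σ) (hρ : IsTrialityRho ρ)
    (x : Q) : σ (ρ (mltL x)) = (mltL x)⁻¹ := by
  simp [hσ x, hρ x]

theorem sigma_rho_mltR (hM : IsMoufang Q) (hσ : IsTrialitySigma σ) (hρ : IsTrialityRho ρ)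
    (x : Q) : σ (ρ (mltR x)) = mltL x * mltR x := by
  simp [hσ x, hρ x, hM.mltL_comm_mltR]

theorem sigma_rho_rho_involutive (hM : IsMoufang Q) (hσ : IsTrialitySigma σ)
    (hρ : IsTrialityRho ρ) (g : Mlt Q) : σ (ρ (ρ (σ (ρ (ρ g))))) = g := by
  induction g using mlt_induction with
  | hL x =>
    rw [sigma_rho_rho_mltL hM hσ hρ]
    simp only [map_mul, sigma_rho_rho_mltL hM hσ hρ, sigma_rho_rho_mltR hσ hρ,
      mul_inv_cancel_right]
  | hR x => simp only [map_inv, sigma_rho_rho_mltR hσ hρ, inv_inv]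
  | one => simp
  | mul g h hg hh => simp only [map_mul, hg, hh]
  | inv g hg => simp only [map_inv, hg]

theorem sigma_rho_involutive (hM : IsMoufang Q) (hσ : IsTrialitySigma σ)
    (hρ : IsTrialityRho ρ) (g : Mlt Q) : σ (ρ (σ (ρ g))) = g := by
  induction g using mlt_induction with
  | hL x => simp only [map_inv, sigma_rho_mltL hσ hρ, inv_inv]
  | hR x =>
    rw [sigma_rho_mltR hM hσ hρ]
    simp only [map_mul, sigma_rho_mltL hσ hρ, sigma_rho_mltR hM hσ hρ, inv_mul_cancel_left]
  | one => simp
  | mul g h hg hh => simp only [map_mul, hg, hh]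
  | inv g hg => simp only [map_inv, hg]

/-- Each `g` in the multiplication group is the third component of the autotopism
`(σρ²(g), σρ(g), g)`. -/
theorem triality_autotopism (hM : IsMoufang Q) (hσ : IsTrialitySigma σ)
    (hρ : IsTrialityRho ρ) (g : Mlt Q) (a b : Q) :
    (σ (ρ (ρ g)) • a) * (σ (ρ g) • b) = g • (a * b) := by
  induction g using mlt_induction generalizing a b with
  | hL x =>
    rw [sigma_rho_rho_mltL hM hσ hρ, sigma_rho_mltL hσ hρ]
    simp only [mul_smul, mltL_smul, mltR_smul, mltL_inv_smul, hM.flexible, ← hM x,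
      Loop.mul_ldiv]
  | hR x =>
    rw [sigma_rho_rho_mltR hσ hρ, sigma_rho_mltR hM hσ hρ]
    simp only [mul_smul, mltL_smul, mltR_smul, mltR_inv_smul, ← hM.right_moufang,
      Loop.rdiv_mul]
  | one => simp
  | mul g h hg hh => simp only [map_mul, mul_smul, hg, hh]
  | inv g hg =>
    rw [eq_inv_smul_iff, ← hg]
    simp

end Triality

/-! ### Orbits of a normal subgroup stable under triality -/

section Orbits

variable {Q : Type*} [Loop Q] (U : Subgroup (Mlt Q)) [hU : U.Normal] (A B : U →* U)

theorem conj_smul_comm (g : Mlt Q) (u : U) (c : Q) :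
    MulAut.conjNormal g u • (g • c) = g • (u • c) := by
  simp only [Subgroup.smul_def, MulAut.conjNormal_apply, smul_smul]
  simp

/-- Since `u = A (A u)`, the autotopism of `A u` absorbs `u`, leaving `(B (A u))⁻¹ * v` on `d`;
moving that past `L_c` conjugates it. The resulting factor does not depend on `d`. -/
theorem smul_mul_smul_eq (hA : ∀ u, A (A u) = u)
    (H : ∀ (u : U) (c d : Q), (A u • c) * (B u • d) = u • (c * d)) (u v : U) (c d : Q) :
    (u • c) * (v • d) =
      (A u * MulAut.conjNormal (mltL c) ((B (A u))⁻¹ * v)) • (c * d) := by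
  have h := H (A u) c (((B (A u))⁻¹ * v) • d)
  rw [hA, smul_smul, mul_inv_cancel_left] at h
  rw [h, mul_smul (A u), ← mltL_smul c d, conj_smul_comm, mltL_smul]

theorem ldiv_smul_smul_eq (hA : ∀ u, A (A u) = u)
    (H : ∀ (u : U) (c d : Q), (A u • c) * (B u • d) = u • (c * d)) (u v : U) (c d : Q) :
    Loop.ldiv (u • c) (v • d) =
      (B (A u) * MulAut.conjNormal (mltL c)⁻¹ ((A u)⁻¹ * v)) • Loop.ldiv c d := by
  apply ldiv_eq_of_mul_eq
  rw [smul_mul_smul_eq U A B hA H, inv_mul_cancel_left, Loop.mul_ldiv, map_inv,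
    MulAut.apply_inv_self, mul_inv_cancel_left]

theorem rdiv_smul_smul_eq (hB : ∀ u, B (B u) = u)
    (H : ∀ (u : U) (c d : Q), (A u • c) * (B u • d) = u • (c * d)) (u v : U) (c d : Q) :
    Loop.rdiv (u • c) (v • d) =
      (A (B v) * MulAut.conjNormal (mltR d)⁻¹ ((B v)⁻¹ * u)) • Loop.rdiv c d := by
  apply rdiv_eq_of_mul_eq
  have h := H (B v) (MulAut.conjNormal (mltR d)⁻¹ ((B v)⁻¹ * u) • Loop.rdiv c d) d
  rw [hB, smul_smul] at h
  rw [h, ← mltR_smul d, ← conj_smul_comm, map_inv, MulAut.apply_inv_self, mltR_smul,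
    Loop.rdiv_mul, smul_smul, mul_inv_cancel_left]

open scoped IsMulCommutative in
/-- Every term operation is affine on the orbits of `U`. -/
theorem exists_hom_eval_smul [IsMulCommutative U] (hA : ∀ u, A (A u) = u)
    (hB : ∀ u, B (B u) = u)
    (H : ∀ (u : U) (c d : Q), (A u • c) * (B u • d) = u • (c * d))
    {ι : Type} (c : ι → Q) (t : LoopTerm ι) :
    ∃ τ : (ι → U) →* U, ∀ u : ι → U, t.eval (fun i => u i • c i) = τ u • t.eval c := by
  induction t with
  | var i => exact ⟨Pi.evalMonoidHom _ i, fun u => rfl⟩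
  | one => exact ⟨1, fun u => (one_smul _ _).symm⟩
  | mul s t hs ht =>
    obtain ⟨f, hf⟩ := hs
    obtain ⟨g, hg⟩ := ht
    -- The conjugating translation depends on `c` only, and pointwise products and inverses of
    -- homomorphisms into the commutative group `U` are again homomorphisms.
    refine ⟨A.comp f * (MulAut.conjNormal (mltL (s.eval c))).toMonoidHom.comp
      (((B.comp A).comp f)⁻¹ * g), fun u => ?_⟩
    simp only [LoopTerm.eval, hf, hg]
    exact smul_mul_smul_eq U A B hA H _ _ _ _
  | ldiv s t hs ht =>
    obtain ⟨f, hf⟩ := hs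
    obtain ⟨g, hg⟩ := ht
    refine ⟨(B.comp A).comp f * (MulAut.conjNormal (mltL (s.eval c))⁻¹).toMonoidHom.comp
      ((A.comp f)⁻¹ * g), fun u => ?_⟩
    simp only [LoopTerm.eval, hf, hg]
    exact ldiv_smul_smul_eq U A B hA H _ _ _ _
  | rdiv s t hs ht =>
    obtain ⟨f, hf⟩ := hs
    obtain ⟨g, hg⟩ := ht
    refine ⟨(A.comp B).comp g * (MulAut.conjNormal (mltR (t.eval c))⁻¹).toMonoidHom.comp
      ((B.comp g)⁻¹ * f), fun u => ?_⟩
    simp only [LoopTerm.eval, hf, hg]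
    exact rdiv_smul_smul_eq U A B hB H _ _ _ _

/-- The relation of lying in the same orbit of `U`. -/
def orbitRel (a b : Q) : Prop := ∃ u : U, u • a = b

omit hU in
theorem orbitRel_equivalence : Equivalence (orbitRel (Q := Q) U) where
  refl a := ⟨1, one_smul _ a⟩
  symm := by
    rintro a _ ⟨u, rfl⟩
    exact ⟨u⁻¹, inv_smul_smul u a⟩
  trans := by
    rintro a _ _ ⟨u, rfl⟩ ⟨v, rfl⟩
    exact ⟨v * u, mul_smul v u a⟩

theorem orbitRel_isCongruence (hA : ∀ u, A (A u) = u) (hB : ∀ u, B (B u) = u)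
    (H : ∀ (u : U) (c d : Q), (A u • c) * (B u • d) = u • (c * d)) :
    IsCongruence (orbitRel (Q := Q) U) where
  equiv := orbitRel_equivalence U
  mul := by
    rintro a _ c _ ⟨u, rfl⟩ ⟨v, rfl⟩
    exact ⟨_, (smul_mul_smul_eq U A B hA H u v a c).symm⟩
  ldiv := by
    rintro a _ c _ ⟨u, rfl⟩ ⟨v, rfl⟩
    exact ⟨_, (ldiv_smul_smul_eq U A B hA H u v a c).symm⟩
  rdiv := by
    rintro a _ c _ ⟨u, rfl⟩ ⟨v, rfl⟩
    exact ⟨_, (rdiv_smul_smul_eq U A B hB H u v a c).symm⟩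

theorem orbitRel_centralizes [IsMulCommutative U] (hA : ∀ u, A (A u) = u)
    (hB : ∀ u, B (B u) = u)
    (H : ∀ (u : U) (c d : Q), (A u • c) * (B u • d) = u • (c * d)) :
    Centralizes (orbitRel (Q := Q) U) (orbitRel U) (fun a b => a = b) := by
  rintro n t a _ u v ⟨x, rfl⟩ huv h
  choose y hy using huv
  obtain rfl : (fun i => y i • u i) = v := funext hy
  obtain ⟨τ, hτ⟩ := exists_hom_eval_smul U A B hA hB H (Fin.cons a u : Fin (n + 1) → Q) t
  have cons_smul (x' : U) (y' : Fin n → U) :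
      (Fin.cons (x' • a) (fun i => y' i • u i) : Fin (n + 1) → Q) =
        fun i => (Fin.cons x' y' : Fin (n + 1) → U) i • (Fin.cons a u : Fin (n + 1) → Q) i := by
    funext i
    refine Fin.cases rfl (fun j => rfl) i
  have h1 := cons_smul 1 y
  have h2 := cons_smul x 1
  have h3 := cons_smul x y
  simp only [one_smul, Pi.one_apply] at h1 h2
  have hxy : (Fin.cons x y : Fin (n + 1) → U) = Fin.cons x 1 * Fin.cons 1 y := by
    funext i
    refine Fin.cases ?_ (fun j => ?_) i <;> simp
  -- By `h`, `τ(1, y)` fixes `t(a, u)`; as `τ(x, y) = τ(x, 1) τ(1, y)`, both sides of the goal equal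
  -- `τ(x, 1) t(a, u)`.
  rw [h1, hτ] at h
  rw [h2, h3, hτ, hτ, hxy, map_mul, mul_smul, ← h]

omit hU in
theorem mem_orbitOne_iff {x : Q} : x ∈ orbitOne U ↔ orbitRel U 1 x :=
  ⟨fun ⟨g, hg, h⟩ => ⟨⟨g, hg⟩, h⟩, fun ⟨u, h⟩ => ⟨u, u.2, h⟩⟩

/-- The elements of the multiplication group permute the orbits of `U`. -/
theorem image_orbitOne (g : Mlt Q) :
    (fun x => g • x) '' orbitOne U = {y : Q | orbitRel U (g • (1 : Q)) y} := by
  ext y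
  constructor
  · rintro ⟨x, ⟨w, hw, rfl⟩, rfl⟩
    exact ⟨MulAut.conjNormal g ⟨w, hw⟩, conj_smul_comm U g ⟨w, hw⟩ 1⟩
  · rintro ⟨w, rfl⟩
    refine ⟨MulAut.conjNormal g⁻¹ w • (1 : Q), (mem_orbitOne_iff U).2 ⟨_, rfl⟩, ?_⟩
    change g • _ = _
    rw [← conj_smul_comm, map_inv, MulAut.apply_inv_self]

theorem image_leftTr_orbitOne (c : Q) :
    leftTr c '' orbitOne U = {y : Q | orbitRel U c y} := by
  have h := image_orbitOne U (mltL c)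
  rwa [mltL_smul, Loop.mul_one'] at h

/-- A nontrivial normal subgroup of the multiplication group moves `1`. -/
theorem orbitOne_ne_singleton (hU1 : U ≠ ⊥) : orbitOne U ≠ {1} := by
  intro h
  apply hU1
  rw [Subgroup.eq_bot_iff_forall]
  intro w hw
  refine mlt_ext fun y => ?_
  have hy := image_leftTr_orbitOne U y
  -- The orbit of `y` is `y * U(1)`, so a trivial `U(1)` makes every orbit a singleton.
  rw [h, Set.image_singleton] at hy
  have hmem : w • y ∈ {z : Q | orbitRel U y z} := ⟨⟨w, hw⟩, rfl⟩
  rw [← hy, Set.mem_singleton_iff] at hmem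
  rw [hmem, one_smul]
  exact Loop.mul_one' y

end Orbits

end MoufangTriality

theorem proposition4p2 {Q : Type*} [MoufangTriality.Loop Q] (hM : IsMoufang Q)
    (h3 : IsDivisibleBy Q 3) (hT : AdmitsTriality Q)
    (U : Subgroup (Mlt Q)) (hUnormal : U.Normal) (hUtriality : IsTrialitySubgroup U)
    (hUcomm : ∀ φ ∈ U, ∀ ψ ∈ U, φ * ψ = ψ * φ) (hUnontrivial : U ≠ ⊥) :
    ∃ X : Subloop Q, X.carrier = orbitOne U ∧ X.carrier ≠ {1} ∧ X.IsNormal ∧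
      X.InducesAbelianCongruence := by
  obtain ⟨⟨σ, hσ⟩, ρ, hρ⟩ := hT
  have hσU := hUtriality.1 σ hσ
  have hρU := hUtriality.2 ρ hρ
  have : IsMulCommutative U := ⟨⟨fun a b => Subtype.ext (hUcomm a a.2 b b.2)⟩⟩
  let A : U →* U := ((σ.toMonoidHom.comp (ρ.toMonoidHom.comp ρ.toMonoidHom)).comp
    U.subtype).codRestrict U fun u => hσU _ (hρU _ (hρU _ u.2))
  let B : U →* U := ((σ.toMonoidHom.comp ρ.toMonoidHom).comp
    U.subtype).codRestrict U fun u => hσU _ (hρU _ u.2)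
  have hA (u : U) : A (A u) = u := Subtype.ext (sigma_rho_rho_involutive hM hσ hρ u)
  have hB (u : U) : B (B u) = u := Subtype.ext (sigma_rho_involutive hM hσ hρ u)
  have H (u : U) (c d : Q) : (A u • c) * (B u • d) = u • (c * d) :=
    triality_autotopism hM hσ hρ u c d
  have hcong := orbitRel_isCongruence U A B hA hB H
  let X : Subloop Q :=
    { carrier := orbitOne U
      one_mem := (mem_orbitOne_iff U).2 (hcong.equiv.refl 1)
      mul_mem := fun hx hy => by
        rw [mem_orbitOne_iff] at hx hy ⊢
        simpa only [Loop.mul_one'] using hcong.mul hx hy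
      ldiv_mem := fun hx hy => by
        rw [mem_orbitOne_iff] at hx hy ⊢
        simpa only [ldiv_eq_of_mul_eq (Loop.mul_one' (1 : Q))] using hcong.ldiv hx hy
      rdiv_mem := fun hx hy => by
        rw [mem_orbitOne_iff] at hx hy ⊢
        simpa only [rdiv_eq_of_mul_eq (Loop.mul_one' (1 : Q))] using hcong.rdiv hx hy }
  have hX : X.cosetRel = orbitRel U := by
    funext c d
    refine propext ?_
    change leftTr c '' orbitOne U = leftTr d '' orbitOne U ↔ _
    rw [image_leftTr_orbitOne, image_leftTr_orbitOne]
    constructor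
    · intro h
      have hd : d ∈ {y : Q | orbitRel U d y} := hcong.equiv.refl d
      rwa [← h] at hd
    · intro h
      ext y
      exact ⟨fun hy => hcong.equiv.trans (hcong.equiv.symm h) hy, hcong.equiv.trans h⟩
  refine ⟨X, rfl, orbitOne_ne_singleton U hUnontrivial, ?_, ?_⟩
  · rintro φ ⟨hφ, hφ1⟩
    have h := image_orbitOne U ⟨φ, hφ⟩
    have h1 : (⟨φ, hφ⟩ : Mlt Q) • (1 : Q) = 1 := hφ1
    rw [h1] at h
    refine h.trans (Set.ext fun y => (mem_orbitOne_iff U).symm)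
  · unfold Subloop.InducesAbelianCongruence
    rw [hX]
    exact ⟨hcong, orbitRel_centralizes U A B hA hB H⟩
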